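/- Fix an alphabet $\Sigma=\{1,\dots,d\}$ and a language model $p$, i.e. a map from finite token sequences to probability distributions on $\Sigma$. Let $n>1$, $\delta\in(0,1)$ and $\epsilon=\log(1/\delta)/n$. For a token sequence $A_1,\dots,A_n$ write $P_t=p(\cdot\mid A_1,\dots,A_{t-1})$, and for noise vectors $U_1,\dots,U_n\in[0,1]^\Sigma$ let $V_t=U_{t,A_t}$ and $S_t=S(V_t)$, where $$S(u)=\min\Big(\frac1{\sqrt\epsilon},\frac1{\sqrt{1-u}}\Big)-(2-\sqrt\epsilon).$$ Null hypothesis $\mathbb P_0$: $(U_t)_{t=1}^n$ are independent and uniform on $[0,1]^\Sigma$, and $(U_t)_{t=1}^n$ is independent of $(A_t)_{t=1}^n$. Alternative $\mathbb P_1$ (Gumbel watermarking): $(U_t)_{t=1}^n$ are independent and uniform on $[0,1]^\Sigma$, and $A_t=\arg\max_{a\in\Sigma}P_t(a)/(-\log U_{t,a})$ for every $t$. Let $\tau_\star$ be a critical value with $\mathbb P_0\big(\sum_{t=1}^nS_t\ge\tau_\star\big)=\delta$ (such a value can exist only if $\epsilon<1$). The power-law detector returns "watermarked" if $\sum_{t=1}^nS_t\ge\tau_\star$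 and "unknown" otherwise. For a probability distribution $q$ on $\Sigma$ define $$G_\epsilon(q)=\frac1{\sqrt\epsilon}\sum_{a:\,q(a)\le\epsilon}q(a)(1-q(a))+\sum_{a:\,q(a)>\epsilon}\sqrt{q(a)(1-q(a))},$$ and let $$\tau=\tau(n,\delta)=\sqrt{-2n\log(\epsilon)\log(1/\delta)}+\frac{3\log(1/\delta)}{2\sqrt\epsilon}.$$ Then there is a universal constant $C>0$ (independent of $d$, $p$, $n$, $\delta$) such that $$\mathbb P_1\Big(\sum_{t=1}^nG_\epsilon(P_t)\ge C\tau\ \text{ and the detector returns "unknown"}\Big)\le2\delta .$$ Moreover $\tau=\Theta\big(\sqrt{n\log(n)\log(1/\delta)}\big)$ as $n\to\infty$ for fixed $\delta$: there are universal constants $c_1,c_2>0$ such that for every $\delta\in(0,1)$ and all sufficiently large $n$ (depending on $\delta$), $c_1\sqrt{n\log(n)\log(1/\delta)}\le\tau\le c_2\sqrt{n\log(n)\log(1/\delta)}$. -/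

import Mathlib

open MeasureTheory ProbabilityTheory Filter

noncomputable section

namespace Watermark

/-- A language model over the tokens `Fin d`: a next-token distribution for each finite sequence of
tokens, written in chronological order. -/
abbrev LanguageModel (d : ℕ) : Type := List (Fin d) → stdSimplex ℝ (Fin d)

/-- The next-token distribution `P_t = p(· | A_1, …, A_{t-1})` along a token sequence `a`
(positions are indexed from zero, so position `t` has the `t` predecessors `a 0, …, a (t-1)`). -/
def nextDist {d n : ℕ} (p : LanguageModel d) (a : Fin n → Fin d) (t : Fin n) : Fin d → ℝ :=
  (p (List.ofFn fun s : Fin t.val => a (Fin.castLE t.isLt.le s))).1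

/-- The uniform distribution on the cube `[0,1]^d`. -/
def uniformCube (d : ℕ) : Measure (Fin d → ℝ) :=
  Measure.pi fun _ => volume.restrict (Set.Icc (0 : ℝ) 1)

/-- The token `b` maximises `P(a) / (-log u_a)` over all tokens `a`. -/
def IsGumbelArgmax {d : ℕ} (P u : Fin d → ℝ) (b : Fin d) : Prop :=
  ∀ a, P a / (-Real.log (u a)) ≤ P b / (-Real.log (u b))

/-- The null hypothesis: the noise vectors are independent and uniform on `[0,1]^d`, and the noise
is independent of the text, whose law is arbitrary. -/
structure NullHypothesis {Ω : Type*} [MeasurableSpace Ω] {d n : ℕ} (P₀ : Measure Ω)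
    (U : Fin n → Ω → Fin d → ℝ) (A : Fin n → Ω → Fin d) : Prop where
  law_noise : ∀ t, P₀.map (U t) = uniformCube d
  indep_noise : iIndepFun U P₀
  indep_text : IndepFun (fun ω t => U t ω) (fun ω t => A t ω) P₀

/-- The alternative hypothesis (text produced by Gumbel watermarking of the model `p`): the noise
vectors are independent and uniform on `[0,1]^d`, and every token is the Gumbel argmax of the
current next-token distribution and the current noise vector. The latter is asked almost surely
only, so that nothing is prescribed on the null event where some noise variable is `0` or `1`; ties
have probability zero as well. -/
structure AlternativeHypothesis {Ω : Type*} [MeasurableSpace Ω] {d n : ℕ} (p : LanguageModel d)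
    (P₁ : Measure Ω) (U : Fin n → Ω → Fin d → ℝ) (A : Fin n → Ω → Fin d) : Prop where
  law_noise : ∀ t, P₁.map (U t) = uniformCube d
  indep_noise : iIndepFun U P₁
  argmax : ∀ᵐ ω ∂P₁, ∀ t, IsGumbelArgmax (nextDist p (fun s => A s ω) t) (U t ω) (A t ω)

/-- `G^q(f) = ∑_a (f(a) (1 - f(a)))^q`. -/
def Gpow {d : ℕ} (q : ℝ) (f : Fin d → ℝ) : ℝ := ∑ a, (f a * (1 - f a)) ^ q

/-- `p_ε(a) = p(a) 1(p(a) ≤ ε)`. -/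
def lowPart {d : ℕ} (ε : ℝ) (p : Fin d → ℝ) (a : Fin d) : ℝ := if p a ≤ ε then p a else 0

/-- `p_ε^c(a) = p(a) 1(p(a) > ε)`. -/
def highPart {d : ℕ} (ε : ℝ) (p : Fin d → ℝ) (a : Fin d) : ℝ := if ε < p a then p a else 0

/-- `G_ε(p) = G^1(p_ε) / √ε + G^{1/2}(p_ε^c)`. -/
def G {d : ℕ} (ε : ℝ) (p : Fin d → ℝ) : ℝ :=
  Gpow 1 (lowPart ε p) / √ε + Gpow (1 / 2) (highPart ε p)

/-- The truncation level `ε = log(1/δ) / n`. -/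
def eps (n : ℕ) (δ : ℝ) : ℝ := Real.log (1 / δ) / n

/-- The truncated power-law score `S(u) = min(1/√ε, 1/√(1-u)) - (2 - √ε)` for `u ∈ [0,1]`, where
`1/√(1-u)` is read as `∞` at `u = 1`. -/
def score (ε u : ℝ) : ℝ :=
  (if u < 1 then min (1 / √ε) (1 / √(1 - u)) else 1 / √ε) - (2 - √ε)

/-- The test statistic `∑_t S(V_t)` with `V_t = U_{t,A_t}`. -/
def statistic {d n : ℕ} (ε : ℝ) (u : Fin n → Fin d → ℝ) (a : Fin n → Fin d) : ℝ :=
  ∑ t, score ε (u t (a t))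

/-- The critical value: the test statistic reaches `τs` with probability exactly `δ` under `P₀`. -/
def IsCriticalValue {Ω : Type*} [MeasurableSpace Ω] {d n : ℕ} (P₀ : Measure Ω)
    (U : Fin n → Ω → Fin d → ℝ) (A : Fin n → Ω → Fin d) (δ τs : ℝ) : Prop :=
  P₀ {ω | τs ≤ statistic (eps n δ) (fun t => U t ω) (fun t => A t ω)} = ENNReal.ofReal δ

/-- The two answers of a detector. -/
inductive Verdict : Type
  | watermarked
  | unknown

/-- Power-law detection with confidence level `δ` and critical value `τs`, applied to the text `a`
and the noise `u` reconstructed from it with the key. -/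
def powerLawDetection {d n : ℕ} (δ τs : ℝ) (u : Fin n → Fin d → ℝ) (a : Fin n → Fin d) : Verdict :=
  if τs ≤ statistic (eps n δ) u a then Verdict.watermarked else Verdict.unknown

/-- `τ = √(-2 n log(ε) log(1/δ)) + 3 log(1/δ) / (2 √ε)` with `ε = log(1/δ) / n`. -/
def tau (n : ℕ) (δ : ℝ) : ℝ :=
  √(-2 * n * Real.log (eps n δ) * Real.log (1 / δ)) + 3 * Real.log (1 / δ) / (2 * √(eps n δ))

end Watermark

end

/-!
Write `ε = log (1/δ) / n`, `T x = 1/√(max ε x)` and `l = log (1/ε)`. The score of `u` is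
`T (1 - u)` minus its mean `2 - √ε` under a uniform `u`, its variance is then at most `l`, and
`τ = n √ε (√(2 l) + 3/2)` (`Watermark.tau_eq`).

*Critical value.* Under the null hypothesis the text may be fixed, the scores are independent,
centred and bounded by `1/√ε`, and a Chernoff bound shows that the statistic reaches `2 τ` with
probability less than `δ`. So the critical value is at most `2 τ`.

*One watermarked step.* For a next-token distribution `q`, the Gumbel argmax is `b` with probability
`q b`, and its noise value is then `w ^ q b` with `w` uniform. As `w ≤ w ^ q`, the score of `w ^ q`
is that of `w` plus some `D ≥ 0`, and `D ≥ T q / 12` for `q ≤ 1/2` and `w ∈ [1/4, 1/2]`. Since `D`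
raises the second moment by at most `2 D / √ε`, the exponential moment of minus the score stays
under control for parameters up to `√ε / 4`
(`Watermark.lintegral_exp_neg_score_rpow_le`). Half the mean of `D` is at least
`(G ε q - √ε) / 192` (`Watermark.gain`, `Watermark.G_le_gain`); the loss of `√ε` per step is harmless as `n √ε ≤ τ`.

*From one step to `n`.* Instead of conditioning on the past, the event is split according to the
whole text `a`. On the part where the text is `a`, the noise at each position `t` makes `a t` the
Gumbel argmax for the fixed distribution `p (· | a_{<t})`, so independence of the noise gives a
product of one-step weights, and these products sum to at most one over all `a`
(`Watermark.sum_prod_prefix_le_one`). Markov's inequality then bounds the probability that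
`∑ G ≥ 1500 τ` while the statistic is below `2 τ` by `δ`. All this needs `ε ≤ 1/4`; for larger `ε`
the bound `G ≤ 1/√ε` excludes `∑ G ≥ 1500 τ` altogether.
-/

open scoped ENNReal

/-! ### The truncated power law -/

namespace Watermark

/-- The truncated power `x ↦ 1 / √(max ε x)`, equal to `min (1/√ε) (1/√x)` for `x > 0`. Up to
centring, the score of `u` is the truncated power of `1 - u`. -/
noncomputable def truncPow (ε x : ℝ) : ℝ := 1 / √(max ε x)

variable {ε : ℝ}

lemma score_eq_truncPow (hε : 0 < ε) (u : ℝ) : score ε u = truncPow ε (1 - u) - (2 - √ε) := by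
  unfold score truncPow
  congr 1
  split_ifs with h
  · rcases le_total ε (1 - u) with h' | h'
    · rw [max_eq_right h', min_eq_right]
      exact one_div_le_one_div_of_le (Real.sqrt_pos.2 hε) (Real.sqrt_le_sqrt h')
    · rw [max_eq_left h', min_eq_left]
      exact one_div_le_one_div_of_le (Real.sqrt_pos.2 (by linarith)) (Real.sqrt_le_sqrt h')
  · rw [max_eq_left (by linarith)]

lemma truncPow_pos (hε : 0 < ε) (x : ℝ) : 0 < truncPow ε x := by
  have : 0 < max ε x := lt_max_of_lt_left hε
  unfold truncPow; positivity

lemma truncPow_sq (hε : 0 < ε) (x : ℝ) : truncPow ε x ^ 2 = 1 / max ε x := by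
  have : 0 < max ε x := lt_max_of_lt_left hε
  rw [truncPow, div_pow, Real.sq_sqrt this.le, one_pow]

lemma truncPow_anti (hε : 0 < ε) {x y : ℝ} (h : x ≤ y) : truncPow ε y ≤ truncPow ε x :=
  one_div_le_one_div_of_le (Real.sqrt_pos.2 (lt_max_of_lt_left hε))
    (Real.sqrt_le_sqrt (max_le_max le_rfl h))

lemma truncPow_le (hε : 0 < ε) (x : ℝ) : truncPow ε x ≤ 1 / √ε :=
  one_div_le_one_div_of_le (Real.sqrt_pos.2 hε) (Real.sqrt_le_sqrt (le_max_left _ _))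

lemma one_le_truncPow (hε : 0 < ε) (hε1 : ε ≤ 1) {x : ℝ} (hx : x ≤ 1) : 1 ≤ truncPow ε x := by
  rw [truncPow, le_div_iff₀ (Real.sqrt_pos.2 (lt_max_of_lt_left hε)), one_mul]
  exact Real.sqrt_le_one.2 (max_le hε1 hx)

lemma continuous_truncPow (hε : 0 < ε) : Continuous (truncPow ε) := by
  unfold truncPow
  refine continuous_const.div (by fun_prop) fun x => ?_
  exact (Real.sqrt_pos.2 (lt_max_of_lt_left hε)).ne'

lemma continuous_score (hε : 0 < ε) : Continuous (score ε) := by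
  have h := continuous_truncPow hε
  rw [show score ε = fun u => truncPow ε (1 - u) - (2 - √ε) from
    funext (score_eq_truncPow hε)]
  fun_prop

lemma integral_truncPow (hε : 0 < ε) (hε1 : ε < 1) : ∫ x in (0:ℝ)..1, truncPow ε x = 2 - √ε := by
  have hi (a b : ℝ) : IntervalIntegrable (truncPow ε) volume a b :=
    (continuous_truncPow hε).intervalIntegrable a b
  rw [← intervalIntegral.integral_add_adjacent_intervals (hi 0 ε) (hi ε 1)]
  have h1 : ∫ x in (0:ℝ)..ε, truncPow ε x = √ε := by
    rw [intervalIntegral.integral_congr (g := fun _ => 1 / √ε)]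
    · have : 0 < √ε := Real.sqrt_pos.2 hε
      have := Real.mul_self_sqrt hε.le
      simp only [intervalIntegral.integral_const, smul_eq_mul]
      field_simp
      nlinarith
    · intro x hx
      rw [Set.uIcc_of_le hε.le] at hx
      simp only [truncPow, max_eq_left hx.2]
  have h2 : ∫ x in ε..1, truncPow ε x = 2 - 2 * √ε := by
    rw [intervalIntegral.integral_congr (g := fun x => x ^ (-(1/2) : ℝ))]
    · rw [integral_rpow (Or.inl (by norm_num)), Real.sqrt_eq_rpow]
      norm_num
      ring
    · intro x hx
      rw [Set.uIcc_of_le hε1.le] at hx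
      simp only [truncPow, max_eq_right hx.1]
      rw [Real.rpow_neg (hε.le.trans hx.1), ← Real.sqrt_eq_rpow, one_div]
  rw [h1, h2]; ring

lemma integral_truncPow_sq (hε : 0 < ε) (hε1 : ε < 1) :
    ∫ x in (0:ℝ)..1, truncPow ε x ^ 2 = 1 - Real.log ε := by
  have hi (a b : ℝ) : IntervalIntegrable (fun x => truncPow ε x ^ 2) volume a b :=
    ((continuous_truncPow hε).pow 2).intervalIntegrable a b
  rw [← intervalIntegral.integral_add_adjacent_intervals (hi 0 ε) (hi ε 1)]
  have h1 : ∫ x in (0:ℝ)..ε, truncPow ε x ^ 2 = 1 := by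
    rw [intervalIntegral.integral_congr (g := fun _ => 1 / ε)]
    · simp only [intervalIntegral.integral_const, smul_eq_mul]
      field_simp
      ring
    · intro x hx
      rw [Set.uIcc_of_le hε.le] at hx
      simp only [truncPow_sq hε, max_eq_left hx.2]
  have h2 : ∫ x in ε..1, truncPow ε x ^ 2 = -Real.log ε := by
    rw [intervalIntegral.integral_congr (g := fun x => 1 / x)]
    · rw [integral_one_div_of_pos hε one_pos, one_div, Real.log_inv]
    · intro x hx
      rw [Set.uIcc_of_le hε1.le] at hx
      simp only [truncPow_sq hε, max_eq_right hx.1]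
  rw [h1, h2]; ring

lemma integral_score (hε : 0 < ε) (hε1 : ε < 1) : ∫ w in Set.Ioo (0:ℝ) 1, score ε w = 0 := by
  rw [← integral_Ioc_eq_integral_Ioo, ← intervalIntegral.integral_of_le zero_le_one]
  simp_rw [score_eq_truncPow hε]
  rw [intervalIntegral.integral_comp_sub_left (fun x => truncPow ε x - (2 - √ε)),
    intervalIntegral.integral_sub ((continuous_truncPow hε).intervalIntegrable _ _)
      (by simp)]
  norm_num
  rw [integral_truncPow hε hε1, sub_self]

lemma integral_score_sq_le (hε : 0 < ε) (hε1 : ε < 1) :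
    ∫ w in Set.Ioo (0:ℝ) 1, score ε w ^ 2 ≤ -Real.log ε := by
  rw [← integral_Ioc_eq_integral_Ioo, ← intervalIntegral.integral_of_le zero_le_one]
  simp_rw [score_eq_truncPow hε]
  rw [intervalIntegral.integral_comp_sub_left (fun x => (truncPow ε x - (2 - √ε)) ^ 2)]
  have hc := continuous_truncPow hε
  have h : ∀ x, (truncPow ε x - (2 - √ε)) ^ 2
      = truncPow ε x ^ 2 - 2 * (2 - √ε) * truncPow ε x + (2 - √ε) ^ 2 := fun x => by ring
  simp_rw [h]
  rw [intervalIntegral.integral_add, intervalIntegral.integral_sub,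
    intervalIntegral.integral_const_mul]
  · norm_num
    rw [integral_truncPow hε hε1, integral_truncPow_sq hε hε1]
    have : √ε ≤ 1 := Real.sqrt_le_one.2 hε1.le
    nlinarith
  all_goals exact Continuous.intervalIntegrable (by fun_prop) _ _

lemma abs_score_le (hε : 0 < ε) (hε1 : ε < 1) {u : ℝ} (hu : 0 ≤ u) : |score ε u| ≤ 1 / √ε := by
  have h1 := truncPow_le hε (1 - u)
  have h2 := one_le_truncPow hε hε1.le (x := 1 - u) (by linarith)
  have h3 : √ε ≤ 1 := Real.sqrt_le_one.2 hε1.le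
  have h4 : 1 ≤ 1 / √ε := by
    rw [le_div_iff₀ (Real.sqrt_pos.2 hε)]; linarith
  have h5 := Real.sqrt_nonneg ε
  rw [score_eq_truncPow hε, abs_le]
  constructor <;> linarith

/-- Under a uniform variable the score, being centred with variance at most `log (1/ε)`, satisfies
Bernstein's bound on exponential moments. -/
lemma lintegral_exp_score_le (hε : 0 < ε) (hε1 : ε < 1) {lam : ℝ} (h0 : 0 ≤ lam) (h1 : lam ≤ √ε) :
    ∫⁻ w in Set.Ioo (0:ℝ) 1, ENNReal.ofReal (Real.exp (lam * score ε w))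
      ≤ ENNReal.ofReal (Real.exp (lam ^ 2 * -Real.log ε)) := by
  have hc := continuous_score hε
  have hint {f : ℝ → ℝ} (hf : Continuous f) : IntegrableOn f (Set.Ioo (0:ℝ) 1) :=
    (hf.integrableOn_Icc (a := 0) (b := 1)).mono_set Set.Ioo_subset_Icc_self
  have hs : 0 < √ε := Real.sqrt_pos.2 hε
  have hb : ∀ w ∈ Set.Ioo (0:ℝ) 1, Real.exp (lam * score ε w)
      ≤ 1 + lam * score ε w + lam ^ 2 * score ε w ^ 2 := by
    intro w hw
    have h2 : |lam * score ε w| ≤ 1 := by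
      rw [abs_mul, abs_of_nonneg h0]
      calc lam * |score ε w| ≤ √ε * (1 / √ε) :=
            mul_le_mul h1 (abs_score_le hε hε1 hw.1.le) (abs_nonneg _) hs.le
        _ = 1 := by field_simp
    have := (abs_le.1 (Real.abs_exp_sub_one_sub_id_le h2)).2
    linarith [mul_pow lam (score ε w) 2]
  rw [← ofReal_integral_eq_lintegral_ofReal (hint (by fun_prop))
    (ae_of_all _ fun w => (Real.exp_pos _).le)]
  refine ENNReal.ofReal_le_ofReal ?_
  calc ∫ w in Set.Ioo (0:ℝ) 1, Real.exp (lam * score ε w)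
      ≤ ∫ w in Set.Ioo (0:ℝ) 1, (1 + lam * score ε w + lam ^ 2 * score ε w ^ 2) :=
        setIntegral_mono_on (hint (by fun_prop)) (hint (by fun_prop)) measurableSet_Ioo hb
    _ = 1 + lam ^ 2 * ∫ w in Set.Ioo (0:ℝ) 1, score ε w ^ 2 := by
        rw [integral_add (hint (by fun_prop)) (hint (by fun_prop)),
          integral_add (hint (by fun_prop)) (hint (by fun_prop)), integral_const_mul,
          integral_const_mul, integral_score hε hε1]
        simp
    _ ≤ 1 + lam ^ 2 * -Real.log ε := by
        have := integral_score_sq_le hε hε1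
        gcongr
    _ ≤ _ := by linarith [Real.add_one_le_exp (lam ^ 2 * -Real.log ε)]

/-! ### Coupling a watermarked noise value with a uniform variable -/

lemma le_rpow_self {w q : ℝ} (hw : w ∈ Set.Ioo (0:ℝ) 1) (hq1 : q ≤ 1) :
    w ≤ w ^ q := by
  simpa using Real.rpow_le_rpow_of_exponent_ge hw.1 hw.2.le hq1

/-- For `w` in the middle range `[1/4, 1/2]`, where the truncation is not active, the score gains at
least a fixed multiple of `truncPow ε q` when `w` is replaced by `w ^ q`. -/
lemma truncPow_gain (hε : 0 < ε) (hε4 : ε ≤ 1 / 4) {q w : ℝ} (hq0 : 0 < q) (hq : q ≤ 1 / 2)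
    (hw1 : 1 / 4 ≤ w) (hw2 : w ≤ 1 / 2) :
    truncPow ε q / 12 ≤ truncPow ε (1 - w ^ q) - truncPow ε (1 - w) := by
  have hw0 : 0 < w := by linarith
  have hT := truncPow_pos hε (1 - w ^ q)
  have hw' := truncPow_pos hε (1 - w)
  have hq' := truncPow_pos hε q
  have hm : 0 < max ε (1 - w ^ q) := lt_max_of_lt_left hε
  -- replacing `w` by `√w` already multiplies `truncPow` by `√(1 + √w) ≥ 6/5`
  have h1 : √w ≤ w ^ q := by
    rw [Real.sqrt_eq_rpow]
    exact Real.rpow_le_rpow_of_exponent_ge hw0 (by linarith) hq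
  have h2 : 1 / 2 ≤ √w := Real.le_sqrt_of_sq_le (by linarith)
  have h3 : max ε (1 - w ^ q) ≤ (25 / 36) * (1 - w) := by
    refine max_le (by linarith) ?_
    have := Real.sq_sqrt hw0.le
    nlinarith
  have h4 : truncPow ε (1 - w) ≤ 5 / 6 * truncPow ε (1 - w ^ q) := by
    refine abs_le_of_sq_le_sq' ?_ (by positivity) |>.2
    rw [mul_pow, truncPow_sq hε, truncPow_sq hε, max_eq_right (by linarith : ε ≤ 1 - w)]
    rw [div_le_iff₀ (by linarith), mul_one_div, div_mul_eq_mul_div, le_div_iff₀ hm]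
    linarith
  have h5 : 1 - w ^ q ≤ 4 * q := by
    have hl : -3 ≤ Real.log w := by
      have := Real.one_sub_inv_le_log_of_pos hw0
      have : w⁻¹ ≤ 4 := by rw [inv_le_comm₀ hw0 (by norm_num)]; linarith
      linarith
    have := Real.add_one_le_exp (Real.log w * q)
    rw [← Real.rpow_def_of_pos hw0] at this
    nlinarith
  have h6 : truncPow ε q / 2 ≤ truncPow ε (1 - w ^ q) := by
    refine abs_le_of_sq_le_sq' ?_ hT.le |>.2
    rw [div_pow, truncPow_sq hε, truncPow_sq hε, div_div]
    refine one_div_le_one_div_of_le hm (max_le ?_ ?_)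
    · linarith [le_max_left ε q]
    · linarith [le_max_right ε q]
  linarith

/-- A lower bound for half of the amount by which watermarking raises the mean score when the
chosen token has probability `q`. The other half of that amount pays for the larger second moment,
and no gain is claimed for `q > 1/2`. -/
noncomputable def gain (ε q : ℝ) : ℝ := if q ≤ 1 / 2 then truncPow ε q / 96 else 0

/-- The noise value of a chosen token of probability `q` is distributed as `w ^ q` with `w`
uniform. Since `w ≤ w ^ q`, the score of `w ^ q` exceeds that of `w` by some `D ≥ 0`, and the
increase of the second moment, at most `2 D / √ε`, is absorbed by the increase of the mean. -/
lemma lintegral_exp_neg_score_rpow_le (hε : 0 < ε) (hε4 : ε ≤ 1 / 4) {lam : ℝ} (h0 : 0 ≤ lam)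
    (h1 : lam ≤ √ε / 4) {q : ℝ} (hq0 : 0 < q) (hq1 : q ≤ 1) :
    ∫⁻ w in Set.Ioo (0:ℝ) 1, ENNReal.ofReal (Real.exp (-lam * score ε (w ^ q)))
      ≤ ENNReal.ofReal (1 + lam ^ 2 * -Real.log ε - lam * gain ε q) := by
  have hc := continuous_score hε
  have hε1 : ε < 1 := by linarith
  have hint {f : ℝ → ℝ} (hf : Continuous f) : IntegrableOn f (Set.Ioo (0:ℝ) 1) :=
    (hf.integrableOn_Icc (a := 0) (b := 1)).mono_set Set.Ioo_subset_Icc_self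
  have hs : 0 < √ε := Real.sqrt_pos.2 hε
  have hpow : Continuous fun w : ℝ => w ^ q := Real.continuous_rpow_const hq0.le
  set I : ℝ → ℝ := (Set.Icc (1 / 4 : ℝ) (1 / 2)).indicator (fun _ => 2 * gain ε q * 2) with hI
  have hIint : IntegrableOn I (Set.Ioo (0:ℝ) 1) :=
    (integrable_const _).indicator measurableSet_Icc
  have hsub : Set.Icc (1 / 4 : ℝ) (1 / 2) ⊆ Set.Ioo 0 1 :=
    fun x hx => ⟨by linarith [hx.1], by linarith [hx.2]⟩
  have hIval : ∫ w in Set.Ioo (0:ℝ) 1, I w = gain ε q := by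
    rw [hI, integral_indicator_const _ measurableSet_Icc, measureReal_restrict_apply
      measurableSet_Icc, Set.inter_eq_left.2 hsub]
    simp only [Real.volume_real_Icc, smul_eq_mul]
    norm_num
    ring
  have hb : ∀ w ∈ Set.Ioo (0:ℝ) 1, Real.exp (-lam * score ε (w ^ q))
      ≤ 1 - lam * score ε w + lam ^ 2 * score ε w ^ 2 - lam * I w := by
    intro w hw
    set D := score ε (w ^ q) - score ε w with hD
    have hD' : D = truncPow ε (1 - w ^ q) - truncPow ε (1 - w) := by
      rw [hD, score_eq_truncPow hε, score_eq_truncPow hε]; ring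
    have hD0 : 0 ≤ D := by
      rw [hD', sub_nonneg]
      exact truncPow_anti hε (by linarith [le_rpow_self hw hq1])
    have hS := abs_score_le hε hε1 (Real.rpow_nonneg hw.1.le q)
    have hS' := abs_score_le hε hε1 hw.1.le
    have h2 : lam * (1 / √ε) ≤ 1 / 4 := by
      rw [mul_one_div, div_le_iff₀ hs]; linarith
    have h3 : |-lam * score ε (w ^ q)| ≤ 1 := by
      rw [abs_mul, abs_neg, abs_of_nonneg h0]
      nlinarith
    have h4 := (abs_le.1 (Real.abs_exp_sub_one_sub_id_le h3)).2
    have h5 : lam * (score ε (w ^ q) + score ε w) ≤ 1 / 2 := by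
      nlinarith [(abs_le.1 hS).2, (abs_le.1 hS').2]
    have h6 : lam * D * (lam * (score ε (w ^ q) + score ε w)) ≤ lam * D * (1 / 2) := by
      gcongr
    have h7 : I w ≤ D / 2 := by
      rw [hI]
      by_cases hw' : w ∈ Set.Icc (1 / 4 : ℝ) (1 / 2)
      · rw [Set.indicator_of_mem hw']
        unfold gain
        split_ifs with hq
        · have := truncPow_gain hε hε4 hq0 hq hw'.1 hw'.2
          rw [← hD'] at this
          linarith
        · linarith
      · rw [Set.indicator_of_notMem hw']
        linarith
    have h8 : lam * I w ≤ lam * (D / 2) := by gcongr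
    have h9 : score ε (w ^ q) = score ε w + D := by rw [hD]; ring
    have h10 : (-lam * score ε (w ^ q)) ^ 2
        = lam ^ 2 * score ε w ^ 2 + lam * D * (lam * (score ε (w ^ q) + score ε w)) := by
      rw [hD]; ring
    have h11 : -lam * score ε (w ^ q) = -lam * score ε w - lam * D := by rw [h9]; ring
    linarith
  have hF : IntegrableOn (fun w => Real.exp (-lam * score ε (w ^ q))) (Set.Ioo (0:ℝ) 1) :=
    hint (Real.continuous_exp.comp (continuous_const.mul (hc.comp hpow)))
  have hP : IntegrableOn (fun w => 1 - lam * score ε w + lam ^ 2 * score ε w ^ 2)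
      (Set.Ioo (0:ℝ) 1) := hint (by fun_prop)
  rw [← ofReal_integral_eq_lintegral_ofReal hF (ae_of_all _ fun w => (Real.exp_pos _).le)]
  refine ENNReal.ofReal_le_ofReal ?_
  calc ∫ w in Set.Ioo (0:ℝ) 1, Real.exp (-lam * score ε (w ^ q))
      ≤ ∫ w in Set.Ioo (0:ℝ) 1, (1 - lam * score ε w + lam ^ 2 * score ε w ^ 2 - lam * I w) :=
        setIntegral_mono_on hF (hP.sub (hIint.const_mul _)) measurableSet_Ioo hb
    _ = 1 + lam ^ 2 * (∫ w in Set.Ioo (0:ℝ) 1, score ε w ^ 2) - lam * gain ε q := by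
        rw [integral_sub hP (hIint.const_mul _),
          integral_add (hint (by fun_prop)) (hint (by fun_prop)),
          integral_sub (hint (by fun_prop)) (hint (by fun_prop)), integral_const_mul,
          integral_const_mul, integral_const_mul, integral_score hε hε1, hIval]
        simp
    _ ≤ _ := by
        have := integral_score_sq_le hε hε1
        gcongr

end Watermark

/-! ### The functional `G` and the total gain -/

namespace Watermark

variable {ε : ℝ} {d : ℕ}

lemma G_eq_sum (ε : ℝ) (q : Fin d → ℝ) :
    G ε q = ∑ a, if q a ≤ ε then q a * (1 - q a) / √ε else √(q a * (1 - q a)) := by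
  unfold G Gpow lowPart highPart
  rw [Finset.sum_div, ← Finset.sum_add_distrib]
  refine Finset.sum_congr rfl fun a _ => ?_
  by_cases h : q a ≤ ε
  · simp [h, not_lt.2 h]
  · simp [h, not_le.1 h, Real.sqrt_eq_rpow]

lemma le_one_of_mem_stdSimplex {q : Fin d → ℝ} (hq : q ∈ stdSimplex ℝ (Fin d)) (a : Fin d) :
    q a ≤ 1 :=
  hq.2 ▸ Finset.single_le_sum (fun b _ => hq.1 b) (Finset.mem_univ a)

lemma sqrt_le_mul_truncPow {x : ℝ} (hxε : ε ≤ x) : √x ≤ x * truncPow ε x := by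
  rw [truncPow, max_eq_right hxε, mul_one_div, Real.div_sqrt]

lemma G_term_le (hε : 0 < ε) {x : ℝ} (hx0 : 0 ≤ x) :
    (if x ≤ ε then x * (1 - x) / √ε else √(x * (1 - x))) ≤ x * truncPow ε x := by
  split_ifs with h
  · rw [truncPow, max_eq_left h, mul_one_div]
    gcongr
    nlinarith
  · have h' : ε < x := not_le.1 h
    refine le_trans (Real.sqrt_le_sqrt ?_) (sqrt_le_mul_truncPow h'.le)
    nlinarith

lemma G_le (hε : 0 < ε) {q : Fin d → ℝ} (hq : q ∈ stdSimplex ℝ (Fin d)) : G ε q ≤ 1 / √ε := by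
  rw [G_eq_sum]
  calc _ ≤ ∑ a, q a * (1 / √ε) := by
        refine Finset.sum_le_sum fun a _ => (G_term_le hε (hq.1 a)).trans ?_
        exact mul_le_mul_of_nonneg_left (truncPow_le hε _) (hq.1 a)
    _ = 1 / √ε := by rw [← Finset.sum_mul, hq.2, one_mul]

lemma gain_nonneg (hε : 0 < ε) (q : ℝ) : 0 ≤ gain ε q := by
  have := truncPow_pos hε q
  unfold gain; split_ifs <;> positivity

/-- A token of probability at most `1/2` contributes at most 96 times its weighted gain to `G`. At
most one token has a probability `1 - x` above `1/2`. It has no gain and contributes at most `√x`,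
where `x` is the total mass of the other tokens; by subadditivity of `y ↦ y * truncPow ε y`, this
is at most what the other tokens contribute, plus `√ε`. -/
lemma G_le_gain (hε : 0 < ε) (hε4 : ε ≤ 1 / 4) {q : Fin d → ℝ} (hq : q ∈ stdSimplex ℝ (Fin d)) :
    G ε q ≤ 192 * ∑ a, q a * gain ε (q a) + √ε := by
  have hs := Real.sqrt_nonneg ε
  have hterm (a : Fin d) (ha : q a ≤ 1 / 2) :
      q a * truncPow ε (q a) = 96 * (q a * gain ε (q a)) := by
    rw [gain, if_pos ha]; ring
  have hnn (a : Fin d) : 0 ≤ q a * gain ε (q a) := mul_nonneg (hq.1 a) (gain_nonneg hε _)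
  rw [G_eq_sum]
  by_cases hall : ∀ a, q a ≤ 1 / 2
  · have h1 : ∑ a, (if q a ≤ ε then q a * (1 - q a) / √ε else √(q a * (1 - q a)))
        ≤ ∑ a, 96 * (q a * gain ε (q a)) :=
      Finset.sum_le_sum fun a _ => (G_term_le hε (hq.1 a)).trans (hterm a (hall a)).le
    rw [← Finset.mul_sum] at h1
    have := Finset.sum_nonneg fun a (_ : a ∈ Finset.univ) => hnn a
    linarith
  · push Not at hall
    obtain ⟨b, hb⟩ := hall
    have hb1 := le_one_of_mem_stdSimplex hq b
    have hsum : ∑ a ∈ Finset.univ.erase b, q a = 1 - q b := by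
      have := Finset.add_sum_erase Finset.univ q (Finset.mem_univ b)
      rw [hq.2] at this; linarith
    have hle (a : Fin d) (ha : a ∈ Finset.univ.erase b) : q a ≤ 1 - q b :=
      hsum ▸ Finset.single_le_sum (fun c _ => hq.1 c) ha
    have hothers : ∑ a ∈ Finset.univ.erase b, q a * truncPow ε (q a)
        = 96 * ∑ a ∈ Finset.univ.erase b, q a * gain ε (q a) := by
      rw [Finset.mul_sum]
      exact Finset.sum_congr rfl fun a ha => hterm a (by linarith [hle a ha])
    have hbig : √(q b * (1 - q b)) ≤ ∑ a ∈ Finset.univ.erase b, q a * truncPow ε (q a) + √ε := by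
      have h1 : √(q b * (1 - q b)) ≤ √(1 - q b) := Real.sqrt_le_sqrt (by nlinarith)
      have h2 : (1 - q b) * truncPow ε (1 - q b)
          ≤ ∑ a ∈ Finset.univ.erase b, q a * truncPow ε (q a) := by
        rw [← hsum, Finset.sum_mul, hsum]
        exact Finset.sum_le_sum fun a ha =>
          mul_le_mul_of_nonneg_left (truncPow_anti hε (hle a ha)) (hq.1 a)
      rcases le_total ε (1 - q b) with h | h
      · linarith [sqrt_le_mul_truncPow h]
      · have h3 := Real.sqrt_le_sqrt h
        have h4 : 0 ≤ ∑ a ∈ Finset.univ.erase b, q a * truncPow ε (q a) :=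
          Finset.sum_nonneg fun a _ => mul_nonneg (hq.1 a) (truncPow_pos hε _).le
        linarith
    have hrest : ∑ a ∈ Finset.univ.erase b,
        (if q a ≤ ε then q a * (1 - q a) / √ε else √(q a * (1 - q a)))
        ≤ ∑ a ∈ Finset.univ.erase b, q a * truncPow ε (q a) :=
      Finset.sum_le_sum fun a _ => G_term_le hε (hq.1 a)
    rw [← Finset.add_sum_erase _ _ (Finset.mem_univ b),
      ← Finset.add_sum_erase _ (fun a => q a * gain ε (q a)) (Finset.mem_univ b),
      if_neg (by linarith)]
    linarith [hnn b]

/-! ### The threshold -/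

lemma log_one_div_eq {n : ℕ} (hn : 0 < n) (δ : ℝ) : Real.log (1 / δ) = n * eps n δ := by
  have : (n : ℝ) ≠ 0 := by positivity
  unfold eps; field_simp

lemma eps_pos {n : ℕ} (hn : 0 < n) {δ : ℝ} (h0 : 0 < δ) (h1 : δ < 1) : 0 < eps n δ := by
  have : 0 < Real.log (1 / δ) := Real.log_pos (by rw [lt_div_iff₀ h0]; linarith)
  unfold eps; positivity

lemma tau_eq {n : ℕ} (hn : 0 < n) {δ : ℝ} (h0 : 0 < δ) (h1 : δ < 1) :
    tau n δ = n * √(eps n δ) * (√(2 * -Real.log (eps n δ)) + 3 / 2) := by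
  have hε := eps_pos hn h0 h1
  have hs := Real.sqrt_pos.2 hε
  have hss := Real.sq_sqrt hε.le
  unfold tau
  rw [log_one_div_eq hn]
  have e1 : -2 * (n : ℝ) * Real.log (eps n δ) * (n * eps n δ)
      = (n * √(eps n δ)) ^ 2 * (2 * -Real.log (eps n δ)) := by
    rw [mul_pow, hss]; ring
  have e2 : 3 * (n * eps n δ) / (2 * √(eps n δ)) = n * √(eps n δ) * (3 / 2) := by
    field_simp
    rw [hss]
  rw [e1, e2, Real.sqrt_mul (sq_nonneg _), Real.sqrt_sq (by positivity)]
  ring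

/-- `τ = Θ(√(n log n log (1/δ)))`: the logarithm of `1/ε = n / log (1/δ)` lies between
`log n / 2` and `3 log n / 2` once `n` is large. -/
lemma tau_asymptotics {δ : ℝ} (h0 : 0 < δ) (h1 : δ < 1) :
    ∀ᶠ n : ℕ in atTop, 1 * √((n : ℝ) * Real.log n * Real.log (1 / δ)) ≤ tau n δ ∧
      tau n δ ≤ 4 * √((n : ℝ) * Real.log n * Real.log (1 / δ)) := by
  have hL : 0 < Real.log (1 / δ) := Real.log_pos (by rw [lt_div_iff₀ h0]; linarith)
  set c := Real.log (Real.log (1 / δ)) with hc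
  have ht : Tendsto (fun n : ℕ => Real.log n) atTop atTop :=
    Real.tendsto_log_atTop.comp tendsto_natCast_atTop_atTop
  filter_upwards [ht.eventually_ge_atTop (max 1 (2 * |c|)), eventually_gt_atTop 0] with n hn hn0
  have hn1 : 1 ≤ Real.log n := (le_max_left _ _).trans hn
  have hn2 : 2 * |c| ≤ Real.log n := (le_max_right _ _).trans hn
  have hnpos : (0 : ℝ) < n := by exact_mod_cast hn0
  have hle := eps_pos hn0 h0 h1
  have hlog : -Real.log (eps n δ) = Real.log n - c := by
    rw [eps, Real.log_div hL.ne' hnpos.ne']; ring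
  have e : √((n : ℝ) * Real.log n * Real.log (1 / δ)) = n * √(eps n δ) * √(Real.log n) := by
    have : (n : ℝ) * Real.log n * Real.log (1 / δ)
        = (n * √(eps n δ)) ^ 2 * Real.log n := by
      rw [mul_pow, Real.sq_sqrt hle.le, log_one_div_eq hn0 δ]; ring
    rw [this, Real.sqrt_mul (sq_nonneg _), Real.sqrt_sq (by positivity)]
  rw [tau_eq hn0 h0 h1, e, hlog]
  have hns : 0 ≤ n * √(eps n δ) := by positivity
  have habs := abs_le.1 (le_refl |c|)
  have l1 : √(Real.log n) ≤ √(2 * (Real.log n - c)) := Real.sqrt_le_sqrt (by linarith)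
  have l2 : √(2 * (Real.log n - c)) ≤ 2 * √(Real.log n) := by
    rw [Real.sqrt_le_left (by positivity), mul_pow, Real.sq_sqrt (by linarith)]
    linarith
  have l3 : 1 ≤ √(Real.log n) := Real.one_le_sqrt.2 hn1
  constructor
  · rw [one_mul]
    exact mul_le_mul_of_nonneg_left (by linarith) hns
  · rw [mul_left_comm]
    exact mul_le_mul_of_nonneg_left (by linarith) hns

end Watermark

/-! ### The law of the chosen token and of its noise value -/

namespace Watermark

lemma uniformCube_eq (d : ℕ) :
    uniformCube d = Measure.pi fun _ => volume.restrict (Set.Ioo (0 : ℝ) 1) := by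
  unfold uniformCube
  simp_rw [Measure.restrict_congr_set (Ioo_ae_eq_Icc (a := (0:ℝ)) (b := 1) (μ := volume))]

instance isProbabilityMeasure_restrict_Ioo :
    IsProbabilityMeasure (volume.restrict (Set.Ioo (0 : ℝ) 1)) :=
  ⟨by simp⟩

lemma lintegral_uniformCube_eval {d : ℕ} (b : Fin d) {f : ℝ → ℝ≥0∞} (hf : Measurable f) :
    ∫⁻ u, f (u b) ∂uniformCube d = ∫⁻ w in Set.Ioo (0 : ℝ) 1, f w := by
  rw [uniformCube_eq]
  exact (measurePreserving_eval (fun _ : Fin d => volume.restrict (Set.Ioo (0 : ℝ) 1)) b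
    ).lintegral_comp hf

lemma ae_uniformCube_mem_Ioo (d : ℕ) : ∀ᵐ u ∂uniformCube d, ∀ a, u a ∈ Set.Ioo (0 : ℝ) 1 := by
  rw [uniformCube_eq, ae_all_iff]
  intro a
  exact (measurePreserving_eval (fun _ : Fin d => volume.restrict (Set.Ioo (0 : ℝ) 1)) a
    ).quasiMeasurePreserving.ae (ae_restrict_mem measurableSet_Ioo)

lemma measurableSet_isGumbelArgmax {d : ℕ} (q : Fin d → ℝ) (b : Fin d) :
    MeasurableSet {u | IsGumbelArgmax q u b} := by
  simp only [IsGumbelArgmax, Set.ofPred_forall]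
  exact MeasurableSet.iInter fun a => measurableSet_le (by fun_prop) (by fun_prop)

/-- Up to a null event, the Gumbel argmax has positive probability. -/
lemma IsGumbelArgmax.pos {d : ℕ} {q u : Fin d → ℝ} {b : Fin d} (hq : q ∈ stdSimplex ℝ (Fin d))
    (hu : ∀ a, u a ∈ Set.Ioo (0 : ℝ) 1) (h : IsGumbelArgmax q u b) : 0 < q b := by
  obtain ⟨a, -, ha⟩ : ∃ a ∈ Finset.univ, 0 < q a := by
    by_contra! hcon
    have := Finset.sum_nonpos hcon
    rw [hq.2] at this; linarith
  have hlog (c : Fin d) : 0 < -Real.log (u c) := neg_pos.2 (Real.log_neg (hu c).1 (hu c).2)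
  exact (div_pos_iff_of_pos_right (hlog b)).1 ((div_pos ha (hlog a)).trans_le (h a))

lemma IsGumbelArgmax.le_rpow {d : ℕ} {q u : Fin d → ℝ} {b : Fin d}
    (hu : ∀ a, u a ∈ Set.Ioo (0 : ℝ) 1) (hb : 0 < q b) (h : IsGumbelArgmax q u b) (a : Fin d) :
    u a ≤ u b ^ (q a / q b) := by
  have hlog (c : Fin d) : 0 < -Real.log (u c) := neg_pos.2 (Real.log_neg (hu c).1 (hu c).2)
  have := h a
  rw [div_le_div_iff₀ (hlog a) (hlog b)] at this
  rw [← Real.log_le_log_iff (hu a).1 (Real.rpow_pos_of_pos (hu b).1 _), Real.log_rpow (hu b).1,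
    div_mul_eq_mul_div, le_div_iff₀ hb]
  linarith

/-- The substitution `v = w ^ q` on the unit interval. -/
lemma lintegral_mul_rpow {q : ℝ} (hq : 0 < q) (f : ℝ → ℝ≥0∞) :
    ∫⁻ v in Set.Ioo (0 : ℝ) 1, f v * ENNReal.ofReal (v ^ ((1 - q) / q))
      = ENNReal.ofReal q * ∫⁻ w in Set.Ioo (0 : ℝ) 1, f (w ^ q) := by
  have himg : (fun w : ℝ => w ^ q) '' Set.Ioo (0 : ℝ) 1 = Set.Ioo (0 : ℝ) 1 := by
    ext v
    constructor
    · rintro ⟨w, hw, rfl⟩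
      exact ⟨Real.rpow_pos_of_pos hw.1 _, Real.rpow_lt_one hw.1.le hw.2 hq⟩
    · intro hv
      refine ⟨v ^ q⁻¹, ⟨Real.rpow_pos_of_pos hv.1 _,
        Real.rpow_lt_one hv.1.le hv.2 (inv_pos.2 hq)⟩, ?_⟩
      exact Real.rpow_inv_rpow hv.1.le hq.ne'
  have hinj : Set.InjOn (fun w : ℝ => w ^ q) (Set.Ioo (0 : ℝ) 1) := fun x hx y hy hxy =>
    (Real.rpow_left_inj hx.1.le hy.1.le hq.ne').1 hxy
  conv_lhs => rw [← himg]
  rw [lintegral_image_eq_lintegral_abs_deriv_mul measurableSet_Ioo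
    (fun w hw => (Real.hasDerivAt_rpow_const (Or.inl hw.1.ne')).hasDerivWithinAt) hinj,
    ← lintegral_const_mul' _ _ ENNReal.ofReal_ne_top]
  refine setLIntegral_congr_fun measurableSet_Ioo fun w hw => ?_
  have hw1 := Real.rpow_pos_of_pos hw.1 (q - 1)
  rw [← Real.rpow_mul hw.1.le, mul_div_cancel₀ _ hq.ne', abs_of_pos (mul_pos hq hw1),
    mul_left_comm, ← ENNReal.ofReal_mul (by positivity), mul_assoc, ← Real.rpow_add hw.1]
  norm_num
  rw [mul_comm]

/-- The Gumbel property: token `b` is chosen with probability `q b`, and its noise value is then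
distributed as `w ^ q b` with `w` uniform. Only the inequality `≤` is needed. -/
lemma lintegral_isGumbelArgmax_le {d : ℕ} {q : Fin d → ℝ} (hq : q ∈ stdSimplex ℝ (Fin d))
    (b : Fin d) {f : ℝ → ℝ≥0∞} (hf : Measurable f) :
    ∫⁻ u in {u | IsGumbelArgmax q u b}, f (u b) ∂uniformCube d
      ≤ ENNReal.ofReal (q b) * ∫⁻ w in Set.Ioo (0 : ℝ) 1, f (w ^ q b) := by
  rw [← lintegral_indicator (measurableSet_isGumbelArgmax q b)]
  rcases (hq.1 b).eq_or_lt with hb | hb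
  · refine le_of_eq_of_le ?_ zero_le
    rw [← lintegral_zero (μ := uniformCube d)]
    refine lintegral_congr_ae ?_
    filter_upwards [ae_uniformCube_mem_Ioo d] with u hu
    exact Set.indicator_of_notMem
      (fun h : IsGumbelArgmax q u b => (h.pos hq hu).ne hb) _
  obtain ⟨k, rfl⟩ : ∃ k, d = k + 1 := ⟨d - 1, by have := b.pos; omega⟩
  -- given the value `v` at `b`, the other coordinates are confined to a box of volume
  -- `v ^ ((1 - q b) / q b)`
  set box : ℝ → Set (Fin k → ℝ) := fun v =>
    Set.univ.pi fun i => Set.Ioc 0 (v ^ (q (b.succAbove i) / q b)) with hbox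
  let μ : Fin (k + 1) → Measure ℝ := fun _ => volume.restrict (Set.Ioo (0 : ℝ) 1)
  have hmeas : Measurable fun z : ℝ × (Fin k → ℝ) =>
      f z.1 * (box z.1).indicator (1 : (Fin k → ℝ) → ℝ≥0∞) z.2 := by
    refine (hf.comp measurable_fst).mul ?_
    have hset : MeasurableSet {z : ℝ × (Fin k → ℝ) | z.2 ∈ box z.1} := by
      simp only [hbox, Set.mem_pi, Set.mem_univ, true_implies, Set.mem_Ioc, Set.ofPred_forall,
        Set.ofPred_and]
      refine MeasurableSet.iInter fun i => MeasurableSet.inter ?_ ?_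
      · exact measurableSet_lt (by fun_prop) (by fun_prop)
      · exact measurableSet_le (by fun_prop) (by fun_prop)
    have h1 : Measurable ({z : ℝ × (Fin k → ℝ) | z.2 ∈ box z.1}.indicator
      (1 : ℝ × (Fin k → ℝ) → ℝ≥0∞)) := measurable_one.indicator hset
    exact h1
  calc ∫⁻ u, {u | IsGumbelArgmax q u b}.indicator (fun u => f (u b)) u ∂uniformCube (k + 1)
      ≤ ∫⁻ u, f (u b) * (box (u b)).indicator (1 : (Fin k → ℝ) → ℝ≥0∞)
          (fun i => u (b.succAbove i)) ∂uniformCube (k + 1) := by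
        refine lintegral_mono_ae ?_
        filter_upwards [ae_uniformCube_mem_Ioo (k + 1)] with u hu
        by_cases h : IsGumbelArgmax q u b
        · have hu' : u ∈ {u | IsGumbelArgmax q u b} := h
          have hmem : (fun i => u (b.succAbove i)) ∈ box (u b) := fun i _ =>
            ⟨(hu _).1, h.le_rpow hu hb _⟩
          rw [Set.indicator_of_mem hmem, Set.indicator_of_mem hu']
          simp
        · have hu' : u ∉ {u | IsGumbelArgmax q u b} := h
          rw [Set.indicator_of_notMem hu']
          exact zero_le
    _ = ∫⁻ z, f z.1 * (box z.1).indicator (1 : (Fin k → ℝ) → ℝ≥0∞) z.2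
          ∂((μ b).prod (Measure.pi fun j => μ (b.succAbove j))) := by
        rw [uniformCube_eq]
        exact (measurePreserving_piFinSuccAbove μ b).lintegral_comp hmeas
    _ = ∫⁻ v in Set.Ioo (0 : ℝ) 1, f v * ENNReal.ofReal (v ^ ((1 - q b) / q b)) := by
        rw [lintegral_prod _ hmeas.aemeasurable]
        refine setLIntegral_congr_fun measurableSet_Ioo fun v hv => ?_
        have hbm : MeasurableSet (box v) := MeasurableSet.univ_pi fun i => measurableSet_Ioc
        dsimp only
        rw [lintegral_const_mul _ (measurable_one.indicator hbm), lintegral_indicator_one hbm,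
          Measure.pi_pi]
        congr 1
        have hvol (i : Fin k) : μ (b.succAbove i) (Set.Ioc 0 (v ^ (q (b.succAbove i) / q b)))
            = ENNReal.ofReal (v ^ (q (b.succAbove i) / q b)) := by
          have hle : v ^ (q (b.succAbove i) / q b) ≤ 1 :=
            Real.rpow_le_one hv.1.le hv.2.le (div_nonneg (hq.1 _) hb.le)
          simp only [μ]
          rw [Measure.restrict_congr_set (Ioo_ae_eq_Ioc (a := (0:ℝ)) (b := 1) (μ := volume)),
            Measure.restrict_apply measurableSet_Ioc, Set.inter_eq_left.2
            (Set.Ioc_subset_Ioc_right hle), Real.volume_Ioc, sub_zero]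
        have hsum : 1 - q b = ∑ i, q (b.succAbove i) := by
          rw [← hq.2, Fin.sum_univ_succAbove _ b]; ring
        rw [Finset.prod_congr rfl fun i _ => hvol i,
          ← ENNReal.ofReal_prod_of_nonneg fun i _ => Real.rpow_nonneg hv.1.le _,
          ← Real.rpow_sum_of_pos hv.1, ← Finset.sum_div, hsum]
    _ = _ := lintegral_mul_rpow hb f

end Watermark

/-! ### Exponential moments along a token sequence -/

namespace Watermark

variable {ε : ℝ} {d n : ℕ}

/-- The exponential compensator of one watermarked step: normalised in this way, the exponential
moment of the score is at most one, whatever the next-token distribution `q`. -/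
lemma sum_lintegral_isGumbelArgmax_le_one (hε : 0 < ε) (hε4 : ε ≤ 1 / 4) {lam : ℝ} (h0 : 0 ≤ lam)
    (h1 : lam ≤ √ε / 4) {q : Fin d → ℝ} (hq : q ∈ stdSimplex ℝ (Fin d)) :
    ∑ b, ∫⁻ u in {u | IsGumbelArgmax q u b}, ENNReal.ofReal (Real.exp (-lam * score ε (u b)
      + (lam * ∑ a, q a * gain ε (q a) - lam ^ 2 * -Real.log ε))) ∂uniformCube d ≤ 1 := by
  set κ := lam * ∑ a, q a * gain ε (q a) - lam ^ 2 * -Real.log ε with hκ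
  have hc := continuous_score hε
  have hs : 0 < √ε := Real.sqrt_pos.2 hε
  have hl : 0 ≤ -Real.log ε := neg_nonneg.2 (Real.log_nonpos hε.le (by linarith))
  have hnn (b : Fin d) : 0 ≤ 1 + lam ^ 2 * -Real.log ε - lam * gain ε (q b) := by
    have h2 : gain ε (q b) ≤ 1 / √ε := by
      have := truncPow_le hε (q b)
      have := truncPow_pos hε (q b)
      unfold gain; split_ifs
      · linarith
      · positivity
    have h3 : lam * gain ε (q b) ≤ √ε / 4 * (1 / √ε) :=
      mul_le_mul h1 h2 (gain_nonneg hε _) (by positivity)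
    have h4 : √ε / 4 * (1 / √ε) = 1 / 4 := by field_simp
    have := mul_nonneg (sq_nonneg lam) hl
    linarith
  have hstep (b : Fin d) : ∫⁻ u in {u | IsGumbelArgmax q u b},
      ENNReal.ofReal (Real.exp (-lam * score ε (u b) + κ)) ∂uniformCube d
      ≤ ENNReal.ofReal (q b * (1 + lam ^ 2 * -Real.log ε - lam * gain ε (q b)) * Real.exp κ) := by
    have hf : Measurable fun v : ℝ => ENNReal.ofReal (Real.exp (-lam * score ε v)) := by
      fun_prop
    simp_rw [Real.exp_add, ENNReal.ofReal_mul (Real.exp_pos _).le]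
    rw [lintegral_mul_const' _ _ ENNReal.ofReal_ne_top, ENNReal.ofReal_mul
      (mul_nonneg (hq.1 b) (hnn b)), ENNReal.ofReal_mul (hq.1 b)]
    gcongr
    refine (lintegral_isGumbelArgmax_le hq b hf).trans ?_
    rcases (hq.1 b).eq_or_lt with hb | hb
    · simp [← hb]
    · gcongr
      exact lintegral_exp_neg_score_rpow_le hε hε4 h0 h1 hb (le_one_of_mem_stdSimplex hq b)
  refine (Finset.sum_le_sum fun b _ => hstep b).trans ?_
  rw [← ENNReal.ofReal_sum_of_nonneg fun b _ =>
    mul_nonneg (mul_nonneg (hq.1 b) (hnn b)) (Real.exp_pos _).le, ← Finset.sum_mul]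
  have hsum : ∑ b, q b * (1 + lam ^ 2 * -Real.log ε - lam * gain ε (q b)) = 1 - κ := by
    calc _ = (1 + lam ^ 2 * -Real.log ε) * ∑ b, q b - lam * ∑ b, q b * gain ε (q b) := by
          rw [Finset.mul_sum, Finset.mul_sum, ← Finset.sum_sub_distrib]
          exact Finset.sum_congr rfl fun b _ => by ring
      _ = 1 - κ := by rw [hq.2, hκ]; ring
  rw [hsum, ENNReal.ofReal_le_one]
  calc (1 - κ) * Real.exp κ ≤ Real.exp (-κ) * Real.exp κ := by
        gcongr
        linarith [Real.add_one_le_exp (-κ)]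
    _ = 1 := by rw [← Real.exp_add]; simp

/-- A discrete substitute for conditioning on the past: if the weights of the next token sum to at
most one after every prefix, so do the weights of all sequences of length `n`. -/
lemma sum_prod_prefix_le_one (m : List (Fin d) → Fin d → ℝ≥0∞) (hm : ∀ l, ∑ b, m l b ≤ 1) :
    ∑ a : Fin n → Fin d,
      ∏ t, m (List.ofFn fun s : Fin t.val => a (Fin.castLE t.isLt.le s)) (a t) ≤ 1 := by
  induction n generalizing m with
  | zero => simp
  | succ n ih =>
    rw [← (Fin.consEquiv fun _ : Fin (n + 1) => Fin d).sum_comp, Fintype.sum_prod_type]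
    refine le_trans (Finset.sum_le_sum fun b _ => ?_) (hm [])
    have key (a : Fin n → Fin d) :
        ∏ t : Fin (n + 1), m (List.ofFn fun s : Fin t.val =>
          (Fin.cons b a : Fin (n + 1) → Fin d) (Fin.castLE t.isLt.le s))
          ((Fin.cons b a : Fin (n + 1) → Fin d) t)
        = m [] b * ∏ t : Fin n,
          m (b :: List.ofFn fun s : Fin t.val => a (Fin.castLE t.isLt.le s)) (a t) := by
      rw [Fin.prod_univ_succ]
      congr 1
      refine Finset.prod_congr rfl fun t _ => ?_
      have hl : (List.ofFn fun s : Fin t.succ.val =>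
          (Fin.cons b a : Fin (n + 1) → Fin d) (Fin.castLE t.succ.isLt.le s))
          = b :: List.ofFn fun s : Fin t.val => a (Fin.castLE t.isLt.le s) := by
        change (List.ofFn fun s : Fin (t.val + 1) => _) = _
        rw [List.ofFn_succ]
        rfl
      rw [hl, Fin.cons_succ]
    calc _ = ∑ a : Fin n → Fin d, m [] b * ∏ t : Fin n,
          m (b :: List.ofFn fun s : Fin t.val => a (Fin.castLE t.isLt.le s)) (a t) :=
          Finset.sum_congr rfl fun a _ => key a
      _ ≤ m [] b * 1 := by
          rw [← Finset.mul_sum]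
          gcongr
          exact ih (fun l => m (b :: l)) fun l => hm (b :: l)
      _ = m [] b := mul_one _

variable {Ω : Type*} [MeasurableSpace Ω]

lemma lintegral_prod_noise {P : Measure Ω} {U : Fin n → Ω → Fin d → ℝ}
    (hU : ∀ t, Measurable (U t)) (hlaw : ∀ t, P.map (U t) = uniformCube d)
    (hind : iIndepFun U P) {f : Fin n → (Fin d → ℝ) → ℝ≥0∞} (hf : ∀ t, Measurable (f t)) :
    ∫⁻ ω, ∏ t, f t (U t ω) ∂P = ∏ t, ∫⁻ u, f t u ∂uniformCube d := by
  have h := lintegral_prod_eq_prod_lintegral_of_indepFun Finset.univ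
    (fun t => f t ∘ U t) (hind.comp f hf) fun t => (hf t).comp (hU t)
  simp only [Function.comp_apply] at h
  rw [h]
  exact Finset.prod_congr rfl fun t _ => by rw [← hlaw t, lintegral_map (hf t) (hU t)]

/-! ### Tail bounds under the two hypotheses -/

/-- The text being independent of the noise, it may be fixed, and the Chernoff bound applies. -/
lemma NullHypothesis.measure_le_statistic_le (hε : 0 < ε) (hε1 : ε < 1) {lam : ℝ} (h0 : 0 ≤ lam)
    (h1 : lam ≤ √ε) {P₀ : Measure Ω} [IsProbabilityMeasure P₀] {U : Fin n → Ω → Fin d → ℝ}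
    {A : Fin n → Ω → Fin d} (hU : ∀ t, Measurable (U t)) (hA : ∀ t, Measurable (A t))
    (h : NullHypothesis P₀ U A) (s : ℝ) :
    P₀ {ω | s ≤ statistic ε (fun t => U t ω) (fun t => A t ω)}
      ≤ ENNReal.ofReal (Real.exp (n * (lam ^ 2 * -Real.log ε) - lam * s)) := by
  have hc := continuous_score hε
  set K := ENNReal.ofReal (Real.exp (n * (lam ^ 2 * -Real.log ε) - lam * s)) with hK
  let V : Ω → Fin n → Fin d → ℝ := fun ω t => U t ω
  let B : Ω → Fin n → Fin d := fun ω t => A t ω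
  have hB : Measurable B := measurable_pi_lambda _ hA
  let Z : (Fin n → Fin d) → (Fin n → Fin d → ℝ) → ℝ≥0∞ := fun a u =>
    ENNReal.ofReal (Real.exp (-(lam * s))) *
      ∏ t, ENNReal.ofReal (Real.exp (lam * score ε (u t (a t))))
  have hfm (b : Fin d) : Measurable fun u : Fin d → ℝ =>
      ENNReal.ofReal (Real.exp (lam * score ε (u b))) := by fun_prop
  have hZm (a) : Measurable (Z a) :=
    (Finset.measurable_fun_prod _ fun t _ => (hfm (a t)).comp (measurable_pi_apply t)).const_mul _
  have hZint (a) : ∫⁻ ω, Z a (V ω) ∂P₀ ≤ K := by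
    simp only [Z, V]
    rw [lintegral_const_mul' _ _ ENNReal.ofReal_ne_top,
      lintegral_prod_noise hU h.law_noise h.indep_noise fun t => hfm (a t)]
    calc _ ≤ ENNReal.ofReal (Real.exp (-(lam * s))) *
          ∏ _t : Fin n, ENNReal.ofReal (Real.exp (lam ^ 2 * -Real.log ε)) := by
          gcongr with t
          rw [lintegral_uniformCube_eval (a t)
            (f := fun v => ENNReal.ofReal (Real.exp (lam * score ε v))) (by fun_prop)]
          exact lintegral_exp_score_le hε hε1 h0 h1
      _ = K := by
          rw [Finset.prod_const, Finset.card_univ, Fintype.card_fin,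
            ← ENNReal.ofReal_pow (Real.exp_pos _).le, ← Real.exp_nat_mul,
            ← ENNReal.ofReal_mul (Real.exp_pos _).le, ← Real.exp_add, hK]
          congr 2; ring
  have hsub : {ω | s ≤ statistic ε (fun t => U t ω) (fun t => A t ω)}
      ⊆ ⋃ a, (V ⁻¹' {u | 1 ≤ Z a u} ∩ B ⁻¹' {a}) := by
    intro ω hω
    refine Set.mem_iUnion.2 ⟨B ω, ?_, rfl⟩
    have hω' : s ≤ ∑ t, score ε (U t ω (A t ω)) := hω
    have hZ : Z (B ω) (V ω)
        = ENNReal.ofReal (Real.exp (-(lam * s) + lam * ∑ t, score ε (U t ω (A t ω)))) := by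
      simp only [Z, V, B]
      rw [← ENNReal.ofReal_prod_of_nonneg fun t _ => (Real.exp_pos _).le, ← Real.exp_sum,
        ← ENNReal.ofReal_mul (Real.exp_pos _).le, ← Real.exp_add, Finset.mul_sum]
    change 1 ≤ Z (B ω) (V ω)
    rw [hZ, ENNReal.one_le_ofReal, Real.one_le_exp_iff]
    nlinarith
  calc P₀ _ ≤ ∑ a, P₀ (V ⁻¹' {u | 1 ≤ Z a u} ∩ B ⁻¹' {a}) :=
        (measure_mono hsub).trans (measure_iUnion_fintype_le _ _)
    _ = ∑ a, P₀ (V ⁻¹' {u | 1 ≤ Z a u}) * P₀ (B ⁻¹' {a}) :=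
        Finset.sum_congr rfl fun a _ => h.indep_text.measure_inter_preimage_eq_mul _ _
          (measurableSet_le measurable_const (hZm a)) (measurableSet_singleton a)
    _ ≤ ∑ a, K * P₀ (B ⁻¹' {a}) := by
        gcongr with a
        have := mul_meas_ge_le_lintegral (μ := P₀)
          ((hZm a).comp (measurable_pi_lambda V hU)) 1
        rw [one_mul] at this
        exact this.trans (hZint a)
    _ = K := by
        rw [← Finset.mul_sum, sum_measure_preimage_singleton _
          fun a _ => hB (measurableSet_singleton a)]
        simp

/-- Under watermarking, the event is split according to the value `a` of the whole text. On the
part where the text is `a`, the noise at each position `t` lies in the event that `a t` is the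
Gumbel argmax; with `a` fixed these events are independent. -/
lemma AlternativeHypothesis.measure_statistic_lt_le (hε : 0 < ε) (hε4 : ε ≤ 1 / 4) {lam : ℝ}
    (h0 : 0 ≤ lam) (h1 : lam ≤ √ε / 4) {p : LanguageModel d} {P₁ : Measure Ω}
    {U : Fin n → Ω → Fin d → ℝ} {A : Fin n → Ω → Fin d}
    (hU : ∀ t, Measurable (U t)) (h : AlternativeHypothesis p P₁ U A) (s x : ℝ) :
    P₁ {ω | x ≤ ∑ t, G ε (nextDist p (fun s => A s ω) t) ∧
        statistic ε (fun t => U t ω) (fun t => A t ω) < s}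
      ≤ ENNReal.ofReal (Real.exp
        (lam * s + n * (lam ^ 2 * -Real.log ε) - lam * ((x - n * √ε) / 192))) := by
  have hc := continuous_score hε
  set c := lam * s + n * (lam ^ 2 * -Real.log ε) - lam * ((x - n * √ε) / 192) with hcdef
  let κ : (Fin d → ℝ) → ℝ := fun q =>
    lam * ∑ a, q a * gain ε (q a) - lam ^ 2 * -Real.log ε
  let f : (Fin d → ℝ) → Fin d → (Fin d → ℝ) → ℝ≥0∞ := fun q b =>
    {u | IsGumbelArgmax q u b}.indicator
      fun u => ENNReal.ofReal (Real.exp (-lam * score ε (u b) + κ q))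
  have hfm (q b) : Measurable (f q b) :=
    Measurable.indicator (by fun_prop) (measurableSet_isGumbelArgmax q b)
  let Z : (Fin n → Fin d) → Ω → ℝ≥0∞ := fun a ω =>
    ENNReal.ofReal (Real.exp c) * ∏ t, f (nextDist p a t) (a t) (U t ω)
  have hZm (a) : Measurable (Z a) :=
    (Finset.measurable_fun_prod _ fun t _ => (hfm _ _).comp (hU t)).const_mul _
  have hsub : ({ω | x ≤ ∑ t, G ε (nextDist p (fun s => A s ω) t) ∧
      statistic ε (fun t => U t ω) (fun t => A t ω) < s} : Set Ω)
      ≤ᵐ[P₁] (⋃ a, {ω | 1 ≤ Z a ω} : Set Ω) := by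
    filter_upwards [h.argmax] with ω hω hE
    obtain ⟨hx, hs⟩ := hE
    refine Set.mem_iUnion.2 ⟨fun t => A t ω, ?_⟩
    set q : Fin n → Fin d → ℝ := nextDist p fun t => A t ω with hq
    have hs' : ∑ t, score ε (U t ω (A t ω)) < s := hs
    have hZ : Z (fun t => A t ω) ω = ENNReal.ofReal (Real.exp
        (c + ∑ t, (-lam * score ε (U t ω (A t ω)) + κ (q t)))) := by
      have hft (t : Fin n) : f (q t) (A t ω) (U t ω)
          = ENNReal.ofReal (Real.exp (-lam * score ε (U t ω (A t ω)) + κ (q t))) :=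
        Set.indicator_of_mem (s := {u | IsGumbelArgmax (q t) u (A t ω)}) (hω t) _
      simp only [Z, ← hq]
      rw [Finset.prod_congr rfl fun t _ => hft t,
        ← ENNReal.ofReal_prod_of_nonneg fun t _ => (Real.exp_pos _).le, ← Real.exp_sum,
        ← ENNReal.ofReal_mul (Real.exp_pos _).le, ← Real.exp_add]
    change 1 ≤ Z (fun t => A t ω) ω
    rw [hZ, ENNReal.one_le_ofReal, Real.one_le_exp_iff]
    have hG : ∑ t, G ε (q t) ≤ 192 * ∑ t, ∑ a, q t a * gain ε (q t a) + n * √ε := by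
      calc ∑ t, G ε (q t) ≤ ∑ t, (192 * ∑ a, q t a * gain ε (q t a) + √ε) :=
            Finset.sum_le_sum fun t _ => G_le_gain hε hε4 (Subtype.property (p _))
        _ = _ := by simp [Finset.sum_add_distrib, ← Finset.mul_sum]
    have hsum : ∑ t, (-lam * score ε (U t ω (A t ω)) + κ (q t))
        = -lam * ∑ t, score ε (U t ω (A t ω)) + lam * ∑ t, ∑ a, q t a * gain ε (q t a)
          - n * (lam ^ 2 * -Real.log ε) := by
      simp only [κ, Finset.sum_add_distrib, Finset.sum_sub_distrib, ← Finset.mul_sum,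
        Finset.sum_const, Finset.card_univ, Fintype.card_fin, nsmul_eq_mul]
      ring
    have e1 : lam * ((x - n * √ε) / 192) ≤ lam * ∑ t, ∑ a, q t a * gain ε (q t a) :=
      mul_le_mul_of_nonneg_left (by linarith) h0
    have e2 : lam * ∑ t, score ε (U t ω (A t ω)) ≤ lam * s :=
      mul_le_mul_of_nonneg_left hs'.le h0
    rw [hsum, hcdef]
    linarith
  calc P₁ _ ≤ ∑ a, P₁ {ω | 1 ≤ Z a ω} :=
        (measure_mono_ae hsub).trans (measure_iUnion_fintype_le _ _)
    _ ≤ ∑ a, ∫⁻ ω, Z a ω ∂P₁ := by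
        gcongr with a
        have := mul_meas_ge_le_lintegral (μ := P₁) (hZm a) 1
        rwa [one_mul] at this
    _ = ENNReal.ofReal (Real.exp c) *
        ∑ a : Fin n → Fin d, ∏ t, ∫⁻ u, f (nextDist p a t) (a t) u ∂uniformCube d := by
        rw [Finset.mul_sum]
        refine Finset.sum_congr rfl fun a _ => ?_
        rw [lintegral_const_mul' _ _ ENNReal.ofReal_ne_top,
          lintegral_prod_noise hU h.law_noise h.indep_noise fun t => hfm _ _]
    _ ≤ ENNReal.ofReal (Real.exp c) * 1 := by
        gcongr
        refine sum_prod_prefix_le_one (fun l b => ∫⁻ u, f (p l).1 b u ∂uniformCube d) fun l => ?_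
        refine le_of_eq_of_le (Finset.sum_congr rfl fun b _ =>
          lintegral_indicator (measurableSet_isGumbelArgmax _ _) _) ?_
        exact sum_lintegral_isGumbelArgmax_le_one hε hε4 h0 h1 (p l).2
    _ = _ := mul_one _

end Watermark

/-! ### The critical value and the power of the detector -/

namespace Watermark

variable {d n : ℕ} {Ω : Type*} [MeasurableSpace Ω]

lemma exp_neg_nat_mul_eps (hn : 0 < n) {δ : ℝ} (hδ0 : 0 < δ) :
    Real.exp (-(n * eps n δ)) = δ := by
  rw [← log_one_div_eq hn, one_div, Real.log_inv, neg_neg, Real.exp_log hδ0]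

/-- A critical value is at most `2 τ`, since the statistic reaches `2 τ` with probability less than
`δ` under the null hypothesis. -/
lemma IsCriticalValue.le_two_mul_tau (hn : 0 < n) {δ : ℝ} (hδ0 : 0 < δ) (hδ1 : δ < 1)
    (hε1 : eps n δ < 1) {P₀ : Measure Ω} [IsProbabilityMeasure P₀] {U : Fin n → Ω → Fin d → ℝ}
    {A : Fin n → Ω → Fin d} (hU : ∀ t, Measurable (U t)) (hA : ∀ t, Measurable (A t))
    (h : NullHypothesis P₀ U A) {τs : ℝ} (hτ : IsCriticalValue P₀ U A δ τs) :
    τs ≤ 2 * tau n δ := by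
  by_contra! hlt
  have hε := eps_pos hn hδ0 hδ1
  have hτeq := tau_eq hn hδ0 hδ1
  have hexp := exp_neg_nat_mul_eps hn hδ0
  set ε := eps n δ with hεdef
  have hnpos : (0 : ℝ) < n := by exact_mod_cast hn
  have hl : 0 < -Real.log ε := neg_pos.2 (Real.log_neg hε hε1)
  set r := √(-Real.log ε) with hr
  have hr0 : 0 ≤ r := Real.sqrt_nonneg _
  have hrr : r ^ 2 = -Real.log ε := Real.sq_sqrt hl.le
  have hr2 : r ≤ √(2 * -Real.log ε) := Real.sqrt_le_sqrt (by linarith)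
  have hs : 0 < √ε := Real.sqrt_pos.2 hε
  have hss : √ε * √ε = ε := Real.mul_self_sqrt hε.le
  -- balances the variance and the range terms of the Bernstein exponent
  set lam := √ε / (1 + r) with hlam
  have hlam0 : 0 ≤ lam := by positivity
  have hlamr : lam * (1 + r) = √ε := by rw [hlam]; field_simp
  have hlam1 : lam ≤ √ε := by nlinarith
  have h1 : n * ε ≤ lam * tau n δ := by
    calc n * ε = lam * (n * √ε * (1 + r)) := by
          linear_combination (-(n : ℝ)) * hss - n * √ε * hlamr
      _ ≤ lam * tau n δ := by
        rw [hτeq]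
        gcongr lam * (_ * ?_)
        linarith
  have h2 : n * (lam ^ 2 * -Real.log ε) < n * ε := by
    rw [← hrr, ← mul_pow, ← hss]
    have : 0 < lam := by positivity
    have : lam * r < √ε := by nlinarith
    gcongr
    nlinarith [mul_nonneg hlam0 hr0]
  have hsub : P₀ {ω | τs ≤ statistic ε (fun t => U t ω) (fun t => A t ω)}
      ≤ P₀ {ω | 2 * tau n δ ≤ statistic ε (fun t => U t ω) (fun t => A t ω)} :=
    measure_mono fun ω hω => hlt.le.trans hω
  have htail := h.measure_le_statistic_le hε hε1 hlam0 hlam1 hU hA (2 * tau n δ)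
  have hτ' : P₀ {ω | τs ≤ statistic ε (fun t => U t ω) (fun t => A t ω)}
      = ENNReal.ofReal δ := hτ
  rw [hτ'] at hsub
  have hfin := (ENNReal.ofReal_le_ofReal_iff (Real.exp_pos _).le).1 (hsub.trans htail)
  have : Real.exp (n * (lam ^ 2 * -Real.log ε) - lam * (2 * tau n δ)) < δ :=
    (Real.exp_lt_exp.2 (by linarith)).trans_eq hexp
  linarith

lemma nat_mul_sqrt_eps_le_tau (hn : 0 < n) {δ : ℝ} (hδ0 : 0 < δ) (hδ1 : δ < 1) :
    n * √(eps n δ) ≤ tau n δ := by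
  rw [tau_eq hn hδ0 hδ1]
  exact le_mul_of_one_le_right (by positivity)
    (by linarith [Real.sqrt_nonneg (2 * -Real.log (eps n δ))])

/-- For `ε > 1/4` the sum of the `G ε (P_t)` never reaches the threshold, because `G ≤ 1/√ε`. -/
lemma sum_G_lt_of_quarter_lt_eps (hn : 0 < n) {δ : ℝ} (hδ0 : 0 < δ) (hδ1 : δ < 1)
    (hε4 : 1 / 4 < eps n δ) (p : LanguageModel d) (a : Fin n → Fin d) :
    ∑ t, G (eps n δ) (nextDist p a t) < 1500 * tau n δ := by
  have hε := eps_pos hn hδ0 hδ1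
  have hτge := nat_mul_sqrt_eps_le_tau hn hδ0 hδ1
  set ε := eps n δ
  have hnpos : (0 : ℝ) < n := by exact_mod_cast hn
  have hs : 0 < √ε := Real.sqrt_pos.2 hε
  have hG : ∑ t, G ε (nextDist p a t) ≤ n * (1 / √ε) := by
    refine (Finset.sum_le_sum fun t _ => G_le hε (Subtype.property (p _))).trans ?_
    simp
  have h1 : n * (1 / √ε) < 1500 * (n * √ε) := by
    rw [mul_one_div, div_lt_iff₀ hs, mul_assoc, mul_assoc, Real.mul_self_sqrt hε.le]
    nlinarith
  linarith

/-- Under watermarking, if the statistic is below `2 τ` although `∑ G ≥ C τ`, an event of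
probability at most `δ` has occurred. -/
lemma AlternativeHypothesis.measure_statistic_lt_two_mul_tau_le (hn : 0 < n) {δ : ℝ} (hδ0 : 0 < δ)
    (hδ1 : δ < 1) (hε4 : eps n δ ≤ 1 / 4) {p : LanguageModel d} {P₁ : Measure Ω} {U : Fin n → Ω → Fin d → ℝ}
    {A : Fin n → Ω → Fin d} (hU : ∀ t, Measurable (U t)) (h : AlternativeHypothesis p P₁ U A) :
    P₁ {ω | 1500 * tau n δ ≤ ∑ t, G (eps n δ) (nextDist p (fun s => A s ω) t) ∧
        statistic (eps n δ) (fun t => U t ω) (fun t => A t ω) < 2 * tau n δ}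
      ≤ ENNReal.ofReal δ := by
  have hε := eps_pos hn hδ0 hδ1
  have hτeq := tau_eq hn hδ0 hδ1
  have hτge := nat_mul_sqrt_eps_le_tau hn hδ0 hδ1
  have hexp := exp_neg_nat_mul_eps hn hδ0
  set ε := eps n δ with hεdef
  have hnpos : (0 : ℝ) < n := by exact_mod_cast hn
  have hs : 0 < √ε := Real.sqrt_pos.2 hε
  have hss : √ε * √ε = ε := Real.mul_self_sqrt hε.le
  have hl : 0 < -Real.log ε := neg_pos.2 (Real.log_neg hε (by linarith))
  set r := √(-Real.log ε) with hr
  have hr0 : 0 ≤ r := Real.sqrt_nonneg _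
  have hrr : r ^ 2 = -Real.log ε := Real.sq_sqrt hl.le
  have hr2 : r ≤ √(2 * -Real.log ε) := Real.sqrt_le_sqrt (by linarith)
  -- the constant 1500 makes the resulting exponent at most `-n ε = -log (1/δ)`
  set lam := √ε / (4 * (1 + r)) with hlam
  have hlam0 : 0 ≤ lam := by positivity
  have hlamr : 4 * (lam * (1 + r)) = √ε := by rw [hlam]; field_simp
  have hlam1 : lam ≤ √ε / 4 := by nlinarith
  have h1 : n * ε ≤ 4 * (lam * tau n δ) := by
    calc n * ε = 4 * (lam * (n * √ε * (1 + r))) := by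
          linear_combination (-(n : ℝ)) * hss - n * √ε * hlamr
      _ ≤ 4 * (lam * tau n δ) := by
        rw [hτeq]
        gcongr 4 * (lam * (_ * ?_))
        linarith
  have h2 : n * (lam ^ 2 * -Real.log ε) ≤ n * ε / 16 := by
    rw [← hrr, ← mul_pow, ← hss, mul_div_assoc]
    have : lam * r ≤ √ε / 4 := by nlinarith
    gcongr
    nlinarith [mul_nonneg hlam0 hr0]
  have h3 : lam * (n * √ε) ≤ lam * tau n δ := by gcongr
  refine (h.measure_statistic_lt_le hε hε4 hlam0 hlam1 hU _ _).trans ?_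
  have hnε : 0 < n * ε := by positivity
  exact ENNReal.ofReal_le_ofReal ((Real.exp_le_exp.2 (by linarith)).trans_eq hexp)

end Watermark

theorem theorem1 :
    (∃ C : ℝ, 0 < C ∧
      ∀ (d n : ℕ) (_ : 1 < n) (δ : ℝ) (_ : 0 < δ) (_ : δ < 1)
        (p : Watermark.LanguageModel d)
        (Ω : Type*) [MeasurableSpace Ω]
        (P₀ P₁ : Measure Ω) [IsProbabilityMeasure P₀] [IsProbabilityMeasure P₁]
        (U : Fin n → Ω → Fin d → ℝ) (A : Fin n → Ω → Fin d)
        (_ : ∀ t, Measurable (U t)) (_ : ∀ t, Measurable (A t))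
        (_ : Watermark.NullHypothesis P₀ U A)
        (_ : Watermark.AlternativeHypothesis p P₁ U A)
        (τs : ℝ) (_ : Watermark.IsCriticalValue P₀ U A δ τs),
        P₁ {ω |
            C * Watermark.tau n δ ≤
              ∑ t, Watermark.G (Watermark.eps n δ) (Watermark.nextDist p (fun s => A s ω) t) ∧
            Watermark.powerLawDetection δ τs (fun t => U t ω) (fun t => A t ω)
              = Watermark.Verdict.unknown}
          ≤ ENNReal.ofReal (2 * δ)) ∧
    (∃ c₁ c₂ : ℝ, 0 < c₁ ∧ 0 < c₂ ∧ ∀ δ : ℝ, 0 < δ → δ < 1 →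
      ∀ᶠ n : ℕ in atTop,
        c₁ * √((n : ℝ) * Real.log n * Real.log (1 / δ)) ≤ Watermark.tau n δ ∧
        Watermark.tau n δ ≤ c₂ * √((n : ℝ) * Real.log n * Real.log (1 / δ))) := by

  refine ⟨⟨1500, by norm_num, ?_⟩, 1, 4, one_pos, by norm_num,
    fun δ h0 h1 => Watermark.tau_asymptotics h0 h1⟩
  intro d n hn δ hδ0 hδ1 p Ω _ P₀ P₁ _ _ U A hU hA hnull halt τs hτs
  have hn0 : 0 < n := by omega
  rcases lt_or_ge (1 / 4) (Watermark.eps n δ) with hε4 | hε4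
  · refine le_of_eq_of_le ?_ zero_le
    rw [measure_eq_zero_iff_ae_notMem]
    exact ae_of_all _ fun ω hω => hω.1.not_gt
      (Watermark.sum_G_lt_of_quarter_lt_eps hn0 hδ0 hδ1 hε4 p fun s => A s ω)
  · refine le_trans (measure_mono ?_)
      ((halt.measure_statistic_lt_two_mul_tau_le hn0 hδ0 hδ1 hε4 hU).trans
        (ENNReal.ofReal_le_ofReal (by linarith)))
    rintro ω ⟨hG, hv⟩
    refine ⟨hG, lt_of_not_ge fun hge => ?_⟩
    have hle := hτs.le_two_mul_tau hn0 hδ0 hδ1 (by linarith) hU hA hnull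
    rw [Watermark.powerLawDetection, if_pos (hle.trans hge)] at hv
    cases hv
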